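/- Let $X$ be a Banach space and $Y$ an ordered Banach space (both over $\mathbb K=\mathbb R$ or $\mathbb C$) with closed positive cone, and let $S:D(S)\subset X\to Y$ be a closed linear operator. Put $$C:=\overline{\{x\in D(S): Sx\ge 0\}},\qquad C_G:=\overline{\{x\in D(G)\cap D(S): Sx\ge 0\}}$$ for a linear operator $(G,D(G))$ in $X$. A $C_0$-semigroup on $X$ with generator $G$ is called $S$-shape preserving if $C=C_G$ and the semigroup leaves $C$ invariant. Let $(A,D(A))$ and $(B,D(B))$ generate $S$-shape preserving $C_0$-semigroups $(e^{tA})_{t\ge0}$ and $(e^{tB})_{t\ge0}$ on $X$. Suppose that $A+B$, with domain $D(A)\cap D(B)$, is closable and that its closure $G:=\overline{A+B}$ generates a $C_0$-semigroup $(U(t))_{t\ge0}$, and that there are $M\ge1$ and $\omega\in\mathbb R$ such that $$\big\|(e^{tA}e^{tB})^n\big\|\le Me^{nt\omega}\qquad(t\ge0,\ n\in\mathbb N).$$ Then: 1. $U(t)C\subset C$ for all $t\ge0$; consequently, if $G$ is compatible with $S$, that is, if $C=C_G$, then $(U(t))_{t\ge0}$ is $S$-shape preserving. 2. In each time-step the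 sequential (Lie) splitting and the Strang splitting leave $C$ invariant: for all $t\ge0$, all integers $n\ge1$ and all $x\in C$, $$\big(e^{\frac tnA}e^{\frac tnB}\big)^nx\in C\qquad\text{and}\qquad \big(e^{\frac t{2n}B}e^{\frac tnA}e^{\frac t{2n}B}\big)^nx\in C .$$ -/

import Mathlib

open Set Filter Topology
open scoped NNReal

/-- A strongly continuous one-parameter semigroup `(T(t))_{t ≥ 0}` of bounded linear operators. -/
structure C0Semigroup (𝕜 : Type*) (X : Type*) [RCLike 𝕜] [NormedAddCommGroup X]
    [NormedSpace 𝕜 X] where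
  /-- The underlying family of operators. -/
  toFun : ℝ≥0 → X →L[𝕜] X
  map_zero' : toFun 0 = 1
  map_add' : ∀ s t, toFun (s + t) = toFun s * toFun t
  continuous_orbit' : ∀ x, Continuous fun t => toFun t x

namespace C0Semigroup

instance instCoeFun {𝕜 X : Type*} [RCLike 𝕜] [NormedAddCommGroup X] [NormedSpace 𝕜 X] :
    CoeFun (C0Semigroup 𝕜 X) fun _ => ℝ≥0 → X →L[𝕜] X :=
  ⟨toFun⟩

/-- `T.HasGeneratorAt x y` means that `(T(h)x - x) / h → y` as `h → 0+`. -/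
def HasGeneratorAt {𝕜 X : Type*} [RCLike 𝕜] [NormedAddCommGroup X] [NormedSpace 𝕜 X]
    (T : C0Semigroup 𝕜 X) (x y : X) : Prop :=
  Tendsto (fun h : ℝ≥0 => (((h : ℝ) : 𝕜)⁻¹) • (T h x - x)) (𝓝[>] 0) (𝓝 y)

/-- The graph of the generator: all pairs `(x, y)` with `(T(h)x - x) / h → y` as `h → 0+`. -/
def generatorGraph {𝕜 X : Type*} [RCLike 𝕜] [NormedAddCommGroup X] [NormedSpace 𝕜 X]
    (T : C0Semigroup 𝕜 X) : Submodule 𝕜 (X × X) where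
  carrier := {p | T.HasGeneratorAt p.1 p.2}
  add_mem' := by
    intro p q hp hq
    refine (Tendsto.add hp hq).congr fun h => ?_
    simp only [Prod.fst_add, map_add, ← smul_add]
    congr 1
    abel
  zero_mem' := by simp [HasGeneratorAt]
  smul_mem' := by
    intro c p hp
    refine (Tendsto.const_smul hp c).congr fun h => ?_
    simp only [Prod.smul_fst, map_smul, ← smul_sub]
    exact smul_comm _ _ _

/-- The generator `(A, D(A))` of a strongly continuous semigroup: `D(A)` consists of all `x` for
which the limit `A x = lim_{h → 0+} (T(h)x - x) / h` exists. -/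
noncomputable def generator {𝕜 X : Type*} [RCLike 𝕜] [NormedAddCommGroup X] [NormedSpace 𝕜 X]
    (T : C0Semigroup 𝕜 X) : X →ₗ.[𝕜] X :=
  T.generatorGraph.toLinearPMap

theorem mem_generator_graph_iff {𝕜 X : Type*} [RCLike 𝕜] [NormedAddCommGroup X]
    [NormedSpace 𝕜 X] (T : C0Semigroup 𝕜 X) (x y : X) :
    (x, y) ∈ T.generator.graph ↔
      Tendsto (fun h : ℝ≥0 => (((h : ℝ) : 𝕜)⁻¹) • (T h x - x)) (𝓝[>] 0) (𝓝 y) := by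
  unfold generator
  rw [Submodule.toLinearPMap_graph_eq]
  · rfl
  · rintro ⟨a, b⟩ hab (rfl : a = 0)
    have h0 : Tendsto (fun h : ℝ≥0 => (((h : ℝ) : 𝕜)⁻¹) • (T h 0 - 0)) (𝓝[>] 0) (𝓝 b) := hab
    simp only [map_zero, sub_zero, smul_zero] at h0
    exact tendsto_nhds_unique h0 tendsto_const_nhds

end C0Semigroup

/-- The set `C`, the closure of `{x ∈ D(S) : S x ≥ 0}`. -/
def shapeCone {𝕜 X Y : Type*} [RCLike 𝕜] [NormedAddCommGroup X] [NormedSpace 𝕜 X]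
    [NormedAddCommGroup Y] [NormedSpace 𝕜 Y] [PartialOrder Y] (S : X →ₗ.[𝕜] Y) : Set X :=
  closure {x | ∃ hx : x ∈ S.domain, 0 ≤ S ⟨x, hx⟩}

/-- The set `C_A`, the closure of `{x ∈ D(A) ∩ D(S) : S x ≥ 0}`. -/
def shapeConeOf {𝕜 X Y : Type*} [RCLike 𝕜] [NormedAddCommGroup X] [NormedSpace 𝕜 X]
    [NormedAddCommGroup Y] [NormedSpace 𝕜 Y] [PartialOrder Y] (S : X →ₗ.[𝕜] Y)
    (A : X →ₗ.[𝕜] X) : Set X :=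
  closure {x | x ∈ A.domain ∧ ∃ hx : x ∈ S.domain, 0 ≤ S ⟨x, hx⟩}

/-- The semigroup `T`, with generator `A`, is `S`-shape preserving: `C = C_A`, and `T` leaves `C`
invariant. -/
def C0Semigroup.PreservesShape {𝕜 X Y : Type*} [RCLike 𝕜] [NormedAddCommGroup X]
    [NormedSpace 𝕜 X] [NormedAddCommGroup Y] [NormedSpace 𝕜 Y] [PartialOrder Y]
    (T : C0Semigroup 𝕜 X) (S : X →ₗ.[𝕜] Y) : Prop :=
  shapeCone S = shapeConeOf S T.generator ∧
    ∀ t : ℝ≥0, ∀ x ∈ shapeCone S, T t x ∈ shapeCone S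

/-! The factors `TA h` and `TB h` leave the closed set C invariant, hence so do the powers of `F h =
TA h * TB h`, and it suffices that `U t x` is a limit of vectors `(F h ^ n) x` with `n * h = t`.
This is a form of Chernoff's theorem, `exists_norm_pow_apply_sub_lt`, proved here without
resolvents. For `x` in the generator's domain, sample the orbit at nodes `T (j * d) x`, move each
node slightly in graph norm to a vector where `F` has a right derivative at 0, and join consecutive
nodes by segments. One application of `F h` follows the resulting polygon up to O(h ε), and
stability sums these errors to O(t ε). Density of the domain extends the limit to all `x`. -/

namespace ContinuousLinearMap

variable {𝕜 X : Type*} [RCLike 𝕜] [NormedAddCommGroup X] [NormedSpace 𝕜 X]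

/-- Telescoping estimate for the distance between an orbit of `F` and an approximate orbit. -/
theorem norm_pow_apply_sub_le (F : X →L[𝕜] X) (w : ℕ → X) {n : ℕ} {K e : ℝ}
    (hK : ∀ k ≤ n, ‖F ^ k‖ ≤ K) (hw : ∀ k < n, ‖F (w k) - w (k + 1)‖ ≤ e) :
    ‖(F ^ n) (w 0) - w n‖ ≤ n * (K * e) := by
  have key : ∀ j ≤ n, ‖(F ^ n) (w 0) - (F ^ (n - j)) (w j)‖ ≤ j * (K * e) := by
    intro j
    induction j with
    | zero => simp
    | succ j ih =>
      intro hj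
      have h1 : (F ^ (n - j)) (w j) - (F ^ (n - (j + 1))) (w (j + 1))
          = (F ^ (n - (j + 1))) (F (w j) - w (j + 1)) := by
        rw [show n - j = (n - (j + 1)) + 1 by omega, pow_succ]
        simp
      have h2 : ‖(F ^ (n - (j + 1))) (F (w j) - w (j + 1))‖ ≤ K * e :=
        (le_opNorm _ _).trans (mul_le_mul (hK _ (Nat.sub_le _ _)) (hw j hj) (norm_nonneg _)
          ((norm_nonneg _).trans (hK 0 (Nat.zero_le _))))
      have h3 := norm_sub_le_norm_sub_add_norm_sub ((F ^ n) (w 0)) ((F ^ (n - j)) (w j))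
        ((F ^ (n - (j + 1))) (w (j + 1)))
      rw [h1] at h3
      have h4 := ih (by omega)
      rw [Nat.cast_succ]
      linarith
  simpa using key n le_rfl

/-- If the increments of `F` at `z` and `z'` are close to `(z' - z) / m`, then `F ^ m` almost maps
`z` to `z'`: compare the orbit of `z` with the segment from `z` to `z'`. -/
theorem norm_pow_apply_sub_le_of_segment (F : X →L[𝕜] X) {m : ℕ} (hm : m ≠ 0) {K e : ℝ}
    {z z' : X} (hK : ∀ k ≤ m, ‖F ^ k‖ ≤ K)
    (hz : ‖F z - z - (m : 𝕜)⁻¹ • (z' - z)‖ ≤ e)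
    (hz' : ‖F z' - z' - (m : 𝕜)⁻¹ • (z' - z)‖ ≤ e) :
    ‖(F ^ m) z - z'‖ ≤ m * (K * e) := by
  have hm' : (m : 𝕜) ≠ 0 := Nat.cast_ne_zero.2 hm
  have hmR : (0 : ℝ) < m := Nat.cast_pos.2 (Nat.pos_of_ne_zero hm)
  have := norm_pow_apply_sub_le F (fun k => z + ((k / m : ℝ) : 𝕜) • (z' - z)) (n := m) (e := e)
    hK (by
      intro k hk
      have hk1 : (k / m : ℝ) ≤ 1 := (div_le_one hmR).2 (by exact_mod_cast hk.le)
      have hk0 : (0 : ℝ) ≤ k / m := by positivity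
      -- By linearity the defect along the segment is a convex combination of the two endpoint
      -- defects.
      have : F (z + ((k / m : ℝ) : 𝕜) • (z' - z)) - (z + (((k + 1 : ℕ) / m : ℝ) : 𝕜) • (z' - z))
          = ((1 - k / m : ℝ) : 𝕜) • (F z - z - (m : 𝕜)⁻¹ • (z' - z))
            + ((k / m : ℝ) : 𝕜) • (F z' - z' - (m : 𝕜)⁻¹ • (z' - z)) := by
        simp only [map_add, map_smul, map_sub]
        push_cast
        rw [add_div, one_div]
        module
      rw [this]
      refine (norm_add_le _ _).trans ?_
      rw [norm_smul, norm_smul, RCLike.norm_ofReal, RCLike.norm_ofReal, abs_of_nonneg hk0,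
        abs_of_nonneg (sub_nonneg.2 hk1)]
      nlinarith [mul_le_mul_of_nonneg_left hz (sub_nonneg.2 hk1),
        mul_le_mul_of_nonneg_left hz' hk0])
  simpa [hm'] using this

end ContinuousLinearMap

theorem RCLike.norm_sub_smul_le_iff {𝕜 X : Type*} [RCLike 𝕜] [NormedAddCommGroup X]
    [NormedSpace 𝕜 X] {h : ℝ} (hh : 0 < h) (a b : X) (ε : ℝ) :
    ‖a - (h : 𝕜) • b‖ ≤ h * ε ↔ ‖(h : 𝕜)⁻¹ • a - b‖ ≤ ε := by
  have h0 : (h : 𝕜) ≠ 0 := RCLike.ofReal_ne_zero.2 hh.ne'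
  have : a - (h : 𝕜) • b = (h : 𝕜) • ((h : 𝕜)⁻¹ • a - b) := by
    rw [smul_sub, smul_inv_smul₀ h0]
  rw [this, norm_smul, RCLike.norm_ofReal, abs_of_pos hh, mul_le_mul_iff_right₀ hh]

/-! ### Local bounds, product derivatives and density of the generator's domain. -/

namespace C0Semigroup

variable {𝕜 X : Type*} [RCLike 𝕜] [NormedAddCommGroup X] [NormedSpace 𝕜 X]

theorem zero_apply (T : C0Semigroup 𝕜 X) (x : X) : T 0 x = x := by simp [T.map_zero']

theorem add_apply (T : C0Semigroup 𝕜 X) (s t : ℝ≥0) (x : X) : T (s + t) x = T s (T t x) := by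
  simp [T.map_add']

theorem exists_norm_le [CompleteSpace X] (T : C0Semigroup 𝕜 X) (t : ℝ≥0) :
    ∃ K : ℝ, ∀ s ≤ t, ‖T s‖ ≤ K := by
  obtain ⟨K, hK⟩ := banach_steinhaus (g := fun s : Set.Icc (0 : ℝ≥0) t => T s.1) (by
    intro x
    obtain ⟨C, hC⟩ := (isCompact_Icc (a := (0 : ℝ≥0)) (b := t)).exists_bound_of_continuousOn
      (T.continuous_orbit' x).continuousOn
    exact ⟨C, fun s => hC s.1 s.2⟩)
  exact ⟨K, fun s hs => hK ⟨s, zero_le, hs⟩⟩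

theorem HasGeneratorAt.apply {T : C0Semigroup 𝕜 X} {x y : X} (h : T.HasGeneratorAt x y)
    (s : ℝ≥0) : T.HasGeneratorAt (T s x) (T s y) := by
  refine (((T s).continuous.tendsto y).comp h).congr fun r => ?_
  simp only [Function.comp_apply, map_smul, map_sub, ← add_apply, add_comm]

/-- Strong continuity along convergent families, for locally bounded semigroups. -/
theorem tendsto_apply [CompleteSpace X] (T : C0Semigroup 𝕜 X) {f : ℝ≥0 → X} {y : X}
    (hf : Tendsto f (𝓝[>] 0) (𝓝 y)) : Tendsto (fun h => T h (f h)) (𝓝[>] 0) (𝓝 y) := by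
  obtain ⟨K, hK⟩ := T.exists_norm_le 1
  have h1 : Tendsto (fun h => T h y) (𝓝[>] 0) (𝓝 y) := by
    simpa [T.zero_apply] using ((T.continuous_orbit' y).tendsto 0).mono_left nhdsWithin_le_nhds
  have h2 : Tendsto (fun h => T h (f h - y)) (𝓝[>] 0) (𝓝 0) := by
    have h3 : Tendsto (fun h => K * ‖f h - y‖) (𝓝[>] 0) (𝓝 0) := by
      simpa using (tendsto_iff_norm_sub_tendsto_zero.1 hf).const_mul K
    refine squeeze_zero_norm' ?_ h3
    have : ∀ᶠ h : ℝ≥0 in 𝓝[>] 0, h ≤ 1 :=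
      nhdsWithin_le_nhds (eventually_le_nhds (by norm_num))
    filter_upwards [this] with h hh
    exact (T h).le_of_opNorm_le (hK h hh) _
  simpa using h1.add h2

/-- Split `S h (T h x) - x` as `(S h x - x) + S h (T h x - x)`. -/
theorem HasGeneratorAt.comp [CompleteSpace X] {S T : C0Semigroup 𝕜 X} {x a b : X}
    (ha : S.HasGeneratorAt x a) (hb : T.HasGeneratorAt x b) :
    Tendsto (fun h : ℝ≥0 => (((h : ℝ) : 𝕜)⁻¹) • ((S h * T h) x - x)) (𝓝[>] 0) (𝓝 (a + b)) := by
  refine (Tendsto.add ha (S.tendsto_apply hb)).congr fun h => ?_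
  simp only [map_smul, map_sub, ← smul_add, mul_apply_eq_comp]
  congr 1
  abel

theorem mem_closure_generator_of_real [NormedSpace ℝ X] [IsScalarTower ℝ 𝕜 X] [CompleteSpace X]
    (T : C0Semigroup 𝕜 X) (x : X) : x ∈ closure {z | ∃ y, T.HasGeneratorAt z y} := by
  -- Extending the orbit by the constant `x` to negative times keeps it continuous, so its primitive
  -- is differentiable at 0 as well.
  set g : ℝ → X := fun s => T s.toNNReal x with hg
  have hgc : Continuous g := (T.continuous_orbit' x).comp continuous_real_toNNReal
  set Φ : ℝ → X := fun s => ∫ r in (0 : ℝ)..s, g r with hΦ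
  have hder : ∀ s, HasDerivAt Φ (g s) s := fun s => (hgc.integral_hasStrictDerivAt 0 s).hasDerivAt
  have hΦ0 : Φ 0 = 0 := by simp [hΦ]
  have hcoe : Tendsto (fun h : ℝ≥0 => (h : ℝ)) (𝓝[>] 0) (𝓝[>] 0) := by
    refine tendsto_nhdsWithin_iff.2 ⟨?_, ?_⟩
    · exact (NNReal.continuous_coe.tendsto 0).mono_left nhdsWithin_le_nhds
    · filter_upwards [self_mem_nhdsWithin] with h hh using NNReal.coe_pos.2 hh
  have hslope : ∀ s, Tendsto (fun h : ℝ≥0 => (h : ℝ)⁻¹ • (Φ (s + h) - Φ s)) (𝓝[>] 0) (𝓝 (g s)) :=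
    fun s => ((hder s).tendsto_slope_zero_right).comp hcoe
  have hmem : ∀ d : ℝ≥0, T.HasGeneratorAt (Φ d) (g d - g 0) := by
    intro d
    refine ((hslope d).sub (hslope 0)).congr fun h => ?_
    have hT : T h (Φ d) = Φ (d + h) - Φ h := by
      have h1 : T h (Φ d) = ∫ r in (0 : ℝ)..d, T h (g r) :=
        ((T h).intervalIntegral_comp_comm (hgc.intervalIntegrable _ _)).symm
      have h2 : ∫ r in (0 : ℝ)..d, T h (g r) = ∫ r in (0 : ℝ)..d, g (r + h) := by
        refine intervalIntegral.integral_congr fun r hr => ?_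
        rw [Set.uIcc_of_le d.coe_nonneg] at hr
        simp only [hg, ← T.add_apply]
        rw [Real.toNNReal_add hr.1 h.coe_nonneg, Real.toNNReal_coe, add_comm]
      rw [h1, h2, intervalIntegral.integral_comp_add_right, zero_add, hΦ]
      exact (intervalIntegral.integral_interval_sub_left (hgc.intervalIntegrable _ _)
        (hgc.intervalIntegrable _ _)).symm
    rw [hT, ← smul_sub, RCLike.real_smul_eq_coe_smul (K := 𝕜), RCLike.ofReal_inv, hΦ0, zero_add,
      sub_zero]
    congr 1
    abel
  have hlim := hslope 0
  have hg0 : g 0 = x := by simp [hg, T.zero_apply]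
  rw [hg0] at hlim
  refine mem_closure_of_tendsto hlim (Eventually.of_forall fun h => ?_)
  have := T.generatorGraph.smul_mem (((h : ℝ)⁻¹ : ℝ) : 𝕜)
    (show (Φ h, g h - g 0) ∈ T.generatorGraph from hmem h)
  rw [Set.mem_ofPred_eq, RCLike.real_smul_eq_coe_smul (K := 𝕜), hΦ0, zero_add, sub_zero]
  exact ⟨_, this⟩

/-- The domain of the generator is dense. -/
theorem mem_closure_generator [CompleteSpace X] (T : C0Semigroup 𝕜 X) (x : X) :
    x ∈ closure {z | ∃ y, T.HasGeneratorAt z y} := by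
  let _ : NormedSpace ℝ X := NormedSpace.restrictScalars ℝ 𝕜 X
  have : IsScalarTower ℝ 𝕜 X := ⟨fun r c v => by
    change (r • c) • v = (algebraMap ℝ 𝕜 r) • (c • v)
    rw [Algebra.smul_def, mul_smul]⟩
  exact T.mem_closure_generator_of_real x

/-! ### Chernoff approximation. -/

/-- Chernoff approximation on the domain of the generator. -/
theorem exists_norm_pow_apply_sub_le [CompleteSpace X] (T : C0Semigroup 𝕜 X)
    (F : ℝ≥0 → X →L[𝕜] X) {M ω : ℝ} (hM : 0 ≤ M)
    (hF : ∀ (t : ℝ≥0) (n : ℕ), ‖F t ^ n‖ ≤ M * Real.exp (n * t * ω))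
    (hcore : ∀ x y, T.HasGeneratorAt x y → (x, y) ∈ closure
      {p : X × X | Tendsto (fun h : ℝ≥0 => (((h : ℝ) : 𝕜)⁻¹) • (F h p.1 - p.1)) (𝓝[>] 0) (𝓝 p.2)})
    {x y : X} (hxy : T.HasGeneratorAt x y) {t : ℝ≥0} (ht : 0 < t) :
    ∃ L : ℝ, ∀ ε > 0, ∃ (h : ℝ≥0) (n : ℕ), n * h = t ∧ ‖(F h ^ n) x - T t x‖ ≤ L * ε := by
  obtain ⟨J, hJ⟩ := T.exists_norm_le t
  have hJ0 : 0 ≤ J := (norm_nonneg _).trans (hJ 0 zero_le)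
  set K : ℝ := M * Real.exp (t * |ω|) with hKdef
  have hK0 : 0 ≤ K := by positivity
  have hK : ∀ (h : ℝ≥0) (n : ℕ), n * h ≤ t → ‖F h ^ n‖ ≤ K := by
    intro h n hn
    refine (hF h n).trans (mul_le_mul_of_nonneg_left (Real.exp_le_exp.2 ?_) hM)
    have : ((n : ℝ) * h) ≤ t := by exact_mod_cast hn
    exact (mul_le_mul_of_nonneg_left (le_abs_self ω) (by positivity)).trans
      (mul_le_mul_of_nonneg_right this (abs_nonneg _))
  -- The terms come from moving the initial node, moving the final node, and telescoping twice
  -- (within and across segments), whence `K ^ 2`.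
  refine ⟨K * t + t + t * K ^ 2 * (4 + 2 * J), fun ε hε => ?_⟩
  have htn : ∀ s : ℝ≥0, 0 < s → Tendsto (fun n : ℕ => s / (n : ℝ≥0)) atTop (𝓝[>] 0) := by
    intro s hs
    refine tendsto_nhdsWithin_iff.2 ⟨?_, ?_⟩
    · simpa using tendsto_const_div_atTop_nhds_zero_nat (𝕜 := ℝ≥0) s
    · filter_upwards [eventually_gt_atTop 0] with n hn
      exact div_pos hs (Nat.cast_pos.2 hn)
  -- the mesh `d = t / N` of the nodes
  obtain ⟨N, hN0, hN1, hN2⟩ : ∃ N : ℕ, 0 < N ∧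
      ‖(((t / N : ℝ≥0) : ℝ) : 𝕜)⁻¹ • (T (t / N) x - x) - y‖ ≤ ε ∧ ‖T (t / N) y - y‖ ≤ ε := by
    have e1 : ∀ᶠ h : ℝ≥0 in 𝓝[>] 0, ‖((h : ℝ) : 𝕜)⁻¹ • (T h x - x) - y‖ ≤ ε :=
      (tendsto_iff_norm_sub_tendsto_zero.1 hxy).eventually (eventually_le_nhds hε)
    have e2 : ∀ᶠ h : ℝ≥0 in 𝓝[>] 0, ‖T h y - y‖ ≤ ε :=
      (tendsto_iff_norm_sub_tendsto_zero.1 (T.tendsto_apply (f := fun _ => y)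
        tendsto_const_nhds)).eventually (eventually_le_nhds hε)
    exact ((eventually_gt_atTop 0).and ((htn t ht).eventually (e1.and e2))).exists
  set d : ℝ≥0 := t / N with hd
  have hNpos : (0 : ℝ≥0) < N := Nat.cast_pos.2 hN0
  have hd0 : 0 < d := div_pos ht hNpos
  have hdR : (0 : ℝ) < d := hd0
  have hNd : N * d = t := mul_div_cancel₀ _ hNpos.ne'
  have hjd : ∀ j ≤ N, (j : ℝ≥0) * d ≤ t := by
    intro j hj
    rw [← hNd]
    gcongr
  -- The orbit may leave the set where `F` is differentiable. The tolerance `d * ε` survives the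
  -- later division by `d`.
  have happrox : ∀ j : ℕ, ∃ p : X × X,
      Tendsto (fun h : ℝ≥0 => (((h : ℝ) : 𝕜)⁻¹) • (F h p.1 - p.1)) (𝓝[>] 0) (𝓝 p.2) ∧
        ‖p.1 - T (j * d) x‖ ≤ d * ε ∧ ‖p.2 - T (j * d) y‖ ≤ ε := by
    intro j
    obtain ⟨p, hp, hdist⟩ := Metric.mem_closure_iff.1 (hcore _ _ (hxy.apply (j * d)))
      (min (d * ε) ε) (lt_min (by positivity) hε)
    rw [dist_comm, dist_eq_norm, Prod.norm_def] at hdist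
    exact ⟨p, hp, ((le_max_left _ _).trans hdist.le).trans (min_le_left _ _),
      ((le_max_right _ _).trans hdist.le).trans (min_le_right _ _)⟩
  choose p hp hp1 hp2 using happrox
  -- The nodes are finite in number and already fixed, so one step size serves them all.
  obtain ⟨m, hm0, hm⟩ : ∃ m : ℕ, 0 < m ∧ ∀ j ∈ Finset.range (N + 1),
      ‖(((d / m : ℝ≥0) : ℝ) : 𝕜)⁻¹ • (F (d / m) (p j).1 - (p j).1) - (p j).2‖ ≤ ε := by
    have : ∀ᶠ h : ℝ≥0 in 𝓝[>] 0, ∀ j ∈ Finset.range (N + 1),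
        ‖((h : ℝ) : 𝕜)⁻¹ • (F h (p j).1 - (p j).1) - (p j).2‖ ≤ ε := by
      refine (Finset.eventually_all (Finset.range (N + 1))).2 fun j _ => ?_
      exact (tendsto_iff_norm_sub_tendsto_zero.1 (hp j)).eventually (eventually_le_nhds hε)
    exact ((eventually_gt_atTop 0).and ((htn d hd0).eventually this)).exists
  set h : ℝ≥0 := d / m with hh
  have hmpos : (0 : ℝ≥0) < m := Nat.cast_pos.2 hm0
  have hh0 : (0 : ℝ) < h := div_pos hd0 hmpos
  have hmh : m * h = d := mul_div_cancel₀ _ hmpos.ne'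
  have hmhR : (m : ℝ) * h = d := by exact_mod_cast congrArg NNReal.toReal hmh
  have hNdR : (N : ℝ) * d = t := by exact_mod_cast congrArg NNReal.toReal hNd
  have hstep : ∀ j < N, ‖(F h ^ m) (p j).1 - (p (j + 1)).1‖
      ≤ m * (K * (h * ((4 + 2 * J) * ε))) := by
    intro j hj
    have hTd : ∀ v, T ((j + 1 : ℕ) * d) v = T (j * d) (T d v) := by
      intro v
      rw [← T.add_apply]
      congr 2
      push_cast
      ring
    have hJε : ∀ v, ‖v‖ ≤ ε → ‖T (j * d) v‖ ≤ J * ε := fun v hv =>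
      (T (j * d)).le_of_opNorm_le_of_le (hJ _ (hjd j hj.le)) hv
    have hy : ‖T ((j + 1 : ℕ) * d) y - T (j * d) y‖ ≤ J * ε := by
      rw [hTd, ← map_sub]
      exact hJε _ hN2
    have hx : ‖((d : ℝ) : 𝕜)⁻¹ • (T ((j + 1 : ℕ) * d) x - T (j * d) x) - T (j * d) y‖ ≤ J * ε := by
      rw [hTd, ← map_sub, ← map_smul, ← map_sub]
      exact hJε _ hN1
    have hinv : ∀ v : X, ‖v‖ ≤ d * ε → ‖((d : ℝ) : 𝕜)⁻¹ • v‖ ≤ ε := by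
      intro v hv
      simpa using (RCLike.norm_sub_smul_le_iff (𝕜 := 𝕜) hdR v 0 ε).1 (by simpa using hv)
    set q : X := ((d : ℝ) : 𝕜)⁻¹ • ((p (j + 1)).1 - (p j).1) with hq
    have hqy : ‖T (j * d) y - q‖ ≤ 2 * ε + J * ε := by
      have : T (j * d) y - q = -(((d : ℝ) : 𝕜)⁻¹ • ((p (j + 1)).1 - T ((j + 1 : ℕ) * d) x))
          + ((d : ℝ) : 𝕜)⁻¹ • ((p j).1 - T (j * d) x)
          - (((d : ℝ) : 𝕜)⁻¹ • (T ((j + 1 : ℕ) * d) x - T (j * d) x) - T (j * d) y) := by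
        rw [hq]
        module
      rw [this]
      refine (norm_sub_le _ _).trans (add_le_add ((norm_add_le _ _).trans ?_) hx)
      rw [norm_neg, two_mul]
      exact add_le_add (hinv _ (hp1 (j + 1))) (hinv _ (hp1 j))
    have hmq : (m : 𝕜)⁻¹ • ((p (j + 1)).1 - (p j).1) = ((h : ℝ) : 𝕜) • q := by
      have hm' : (m : 𝕜) ≠ 0 := Nat.cast_ne_zero.2 hm0.ne'
      have hd' : ((d : ℝ) : 𝕜) ≠ 0 := RCLike.ofReal_ne_zero.2 hdR.ne'
      rw [hq, smul_smul]
      congr 1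
      rw [hh]
      push_cast
      field_simp
    -- Here `4 + 2 * J = 1 + (1 + J) + (2 + J)`: quotient of `F`, drift of the derivative, slope of
    -- the segment.
    have hinc : ∀ i ≤ N, ‖(p i).2 - T (j * d) y‖ ≤ ε + J * ε →
        ‖F h (p i).1 - (p i).1 - (m : 𝕜)⁻¹ • ((p (j + 1)).1 - (p j).1)‖
          ≤ h * ((4 + 2 * J) * ε) := by
      intro i hi hiy
      rw [hmq, RCLike.norm_sub_smul_le_iff hh0]
      have h1 := hm i (Finset.mem_range.2 (by omega))
      have h2 := norm_add₃_le (a := ((h : ℝ) : 𝕜)⁻¹ • (F h (p i).1 - (p i).1) - (p i).2)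
        (b := (p i).2 - T (j * d) y) (c := T (j * d) y - q)
      simp only [sub_add_sub_cancel] at h2
      linarith
    refine ContinuousLinearMap.norm_pow_apply_sub_le_of_segment (F h) hm0.ne' ?_
      (hinc j hj.le ?_) (hinc (j + 1) hj ?_)
    · intro k hk
      refine hK h k (le_trans ?_ ((hjd 1 hN0).trans' (by rw [Nat.cast_one, one_mul])))
      rw [← hmh]
      gcongr
    · linarith [hp2 j, mul_nonneg hJ0 hε.le]
    · have := norm_sub_le_norm_sub_add_norm_sub (p (j + 1)).2 (T ((j + 1 : ℕ) * d) y)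
        (T (j * d) y)
      linarith [hp2 (j + 1)]
  refine ⟨h, m * N, ?_, ?_⟩
  · push_cast
    rw [mul_right_comm, hmh, mul_comm, hNd]
  have hcast : ((m * N : ℕ) : ℝ≥0) * h = t := by
    push_cast
    rw [mul_right_comm, hmh, mul_comm, hNd]
  -- Second telescoping: `F h ^ m` is now the single step from node to node.
  have h1 := (F h ^ m).norm_pow_apply_sub_le (fun j => (p j).1) (K := K) (n := N) (by
    intro k hk
    rw [← pow_mul]
    refine hK h _ (hcast ▸ ?_)
    gcongr) hstep
  rw [← pow_mul] at h1
  have h0 : ‖(F h ^ (m * N)) (x - (p 0).1)‖ ≤ K * (d * ε) := by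
    refine (F h ^ (m * N)).le_of_opNorm_le_of_le (hK h _ hcast.le) ?_
    rw [norm_sub_rev]
    simpa [T.zero_apply] using hp1 0
  have h2 : ‖(p N).1 - T t x‖ ≤ d * ε := by simpa [hNd] using hp1 N
  have h3 := norm_add₃_le (a := (F h ^ (m * N)) (x - (p 0).1))
    (b := (F h ^ (m * N)) (p 0).1 - (p N).1) (c := (p N).1 - T t x)
  rw [map_sub, sub_add_sub_cancel, sub_add_sub_cancel, ← map_sub] at h3
  have h4 : (N : ℝ) * (K * (m * (K * (h * ((4 + 2 * J) * ε))))) = t * K ^ 2 * (4 + 2 * J) * ε := by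
    rw [← hNdR, ← hmhR]
    ring
  have hdt : (d : ℝ) ≤ t := by
    have := hjd 1 hN0
    rw [Nat.cast_one, one_mul] at this
    exact_mod_cast this
  have h5 : (d : ℝ) * ε ≤ t * ε := mul_le_mul_of_nonneg_right hdt hε.le
  have h6 := mul_le_mul_of_nonneg_left h5 hK0
  rw [h4] at h1
  linarith

/-- Chernoff approximation: `T t x` is a limit of vectors `F h ^ n x` with `n * h = t`. -/
theorem exists_norm_pow_apply_sub_lt [CompleteSpace X] (T : C0Semigroup 𝕜 X)
    (F : ℝ≥0 → X →L[𝕜] X) {M ω : ℝ} (hM : 0 ≤ M)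
    (hF : ∀ (t : ℝ≥0) (n : ℕ), ‖F t ^ n‖ ≤ M * Real.exp (n * t * ω))
    (hcore : ∀ x y, T.HasGeneratorAt x y → (x, y) ∈ closure
      {p : X × X | Tendsto (fun h : ℝ≥0 => (((h : ℝ) : 𝕜)⁻¹) • (F h p.1 - p.1)) (𝓝[>] 0) (𝓝 p.2)})
    (x : X) (t : ℝ≥0) {ε : ℝ} (hε : 0 < ε) :
    ∃ (h : ℝ≥0) (n : ℕ), n * h = t ∧ ‖(F h ^ n) x - T t x‖ < ε := by
  rcases eq_or_ne t 0 with rfl | ht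
  · exact ⟨0, 0, by simp, by simpa [T.zero_apply] using hε⟩
  set K : ℝ := M * Real.exp (t * ω) + ‖T t‖ with hK
  have hK0 : 0 ≤ K := by positivity
  obtain ⟨z, ⟨y, hzy⟩, hz⟩ := Metric.mem_closure_iff.1 (T.mem_closure_generator x)
    (ε / (2 * (K + 1))) (by positivity)
  obtain ⟨L, hL⟩ := T.exists_norm_pow_apply_sub_le F hM hF hcore hzy (pos_iff_ne_zero.2 ht)
  obtain ⟨h, n, hn, hle⟩ := hL (ε / (2 * (|L| + 1))) (by positivity)
  refine ⟨h, n, hn, ?_⟩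
  have hnR : (n : ℝ) * h = t := by exact_mod_cast congrArg NNReal.toReal hn
  have hop : ‖F h ^ n - T t‖ ≤ K := (norm_sub_le _ _).trans (add_le_add_left
    (by simpa [hnR] using hF h n) _)
  rw [dist_eq_norm] at hz
  have h1 : ‖(F h ^ n - T t) (x - z)‖ ≤ K * (ε / (2 * (K + 1))) :=
    (F h ^ n - T t).le_of_opNorm_le_of_le hop hz.le
  have h2 : K * (ε / (2 * (K + 1))) < ε / 2 := by
    rw [mul_div_assoc', div_lt_div_iff₀ (by positivity) (by positivity)]
    nlinarith
  have h3 : L * (ε / (2 * (|L| + 1))) ≤ ε / 2 := by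
    rw [mul_div_assoc', div_le_div_iff₀ (by positivity) (by positivity)]
    nlinarith [le_abs_self L]
  have h4 : (F h ^ n) x - T t x = (F h ^ n - T t) (x - z) + ((F h ^ n) z - T t z) := by
    simp only [sub_apply, map_sub]
    abel
  rw [h4]
  refine (norm_add_le _ _).trans_lt ?_
  linarith

end C0Semigroup

/-! ### Invariance of the shape cone. -/

theorem ContinuousLinearMap.pow_apply_mem_of_invariant {𝕜 X : Type*} [RCLike 𝕜]
    [NormedAddCommGroup X] [NormedSpace 𝕜 X] {C : Set X} (F : X →L[𝕜] X)
    (hF : ∀ x ∈ C, F x ∈ C) (n : ℕ) : ∀ x ∈ C, (F ^ n) x ∈ C := by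
  induction n with
  | zero => intro x hx; simpa using hx
  | succ n ih =>
    intro x hx
    rw [pow_succ, mul_apply_eq_comp]
    exact ih _ (hF x hx)

theorem mainTheorem6 {𝕜 X Y : Type*} [RCLike 𝕜]
    [NormedAddCommGroup X] [NormedSpace 𝕜 X] [CompleteSpace X]
    [NormedAddCommGroup Y] [NormedSpace 𝕜 Y] [CompleteSpace Y]
    [PartialOrder Y] [IsOrderedAddMonoid Y]
    (hsmul : ∀ (r : ℝ) (y : Y), 0 ≤ r → 0 ≤ y → 0 ≤ (r : 𝕜) • y)
    (hcone : IsClosed {y : Y | 0 ≤ y})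
    (S : X →ₗ.[𝕜] Y) (hS : S.IsClosed)
    (A B : X →ₗ.[𝕜] X) (TA TB U : C0Semigroup 𝕜 X)
    (hA : TA.generator = A) (hB : TB.generator = B)
    (hAS : TA.PreservesShape S) (hBS : TB.PreservesShape S)
    (hclosable : (A + B).IsClosable) (hU : U.generator = (A + B).closure)
    (M ω : ℝ) (hM : 1 ≤ M)
    (hstable : ∀ (t : ℝ≥0) (n : ℕ), ‖(TA t * TB t) ^ n‖ ≤ M * Real.exp (n * t * ω)) :
    (∀ t : ℝ≥0, ∀ x ∈ shapeCone S, U t x ∈ shapeCone S) ∧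
    (shapeCone S = shapeConeOf S (A + B).closure → U.PreservesShape S) ∧
    (∀ (t : ℝ≥0) (n : ℕ), 1 ≤ n → ∀ x ∈ shapeCone S,
      ((TA (t / n) * TB (t / n)) ^ n) x ∈ shapeCone S) ∧
    (∀ (t : ℝ≥0) (n : ℕ), 1 ≤ n → ∀ x ∈ shapeCone S,
      ((TB (t / (2 * n)) * TA (t / n) * TB (t / (2 * n))) ^ n) x ∈ shapeCone S) := by
  have hinvA := hAS.2
  have hinvB := hBS.2
  -- The graph of `U`'s generator is the closure of that of `A + B`, on which the Lie product has
  -- derivative `A z + B z` at 0.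
  have hcore : ∀ x y, U.HasGeneratorAt x y → (x, y) ∈ closure
      {p : X × X | Tendsto (fun h : ℝ≥0 => (((h : ℝ) : 𝕜)⁻¹) • ((TA h * TB h) p.1 - p.1))
        (𝓝[>] 0) (𝓝 p.2)} := by
    intro x y hxy
    have h1 : (x, y) ∈ (A + B).closure.graph := hU ▸ (U.mem_generator_graph_iff x y).2 hxy
    rw [← hclosable.graph_closure_eq_closure_graph] at h1
    refine closure_mono ?_ h1
    rintro ⟨z, w⟩ hzw
    obtain ⟨⟨z', hz'⟩, rfl, rfl⟩ := (LinearPMap.mem_graph_iff _).1 hzw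
    have hzA : (z', A ⟨z', hz'.1⟩) ∈ TA.generator.graph := hA ▸ A.mem_graph ⟨z', hz'.1⟩
    have hzB : (z', B ⟨z', hz'.2⟩) ∈ TB.generator.graph := hB ▸ B.mem_graph ⟨z', hz'.2⟩
    exact C0Semigroup.HasGeneratorAt.comp ((TA.mem_generator_graph_iff _ _).1 hzA)
      ((TB.mem_generator_graph_iff _ _).1 hzB)
  have hlie : ∀ (h : ℝ≥0) (n : ℕ), ∀ x ∈ shapeCone S, ((TA h * TB h) ^ n) x ∈ shapeCone S :=
    fun h n => (TA h * TB h).pow_apply_mem_of_invariant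
      (fun x hx => hinvA h _ (hinvB h x hx)) n
  have hUinv : ∀ t : ℝ≥0, ∀ x ∈ shapeCone S, U t x ∈ shapeCone S := by
    intro t x hx
    have hcl : IsClosed (shapeCone S) := isClosed_closure
    rw [← hcl.closure_eq, Metric.mem_closure_iff]
    intro ε hε
    obtain ⟨h, n, -, hlt⟩ := U.exists_norm_pow_apply_sub_lt (fun h => TA h * TB h)
      (zero_le_one.trans hM) hstable hcore x t hε
    exact ⟨_, hlie h n x hx, by rwa [dist_comm, dist_eq_norm]⟩
  refine ⟨hUinv, fun hG => ⟨hU ▸ hG, hUinv⟩, fun t n _ => hlie _ n, fun t n _ => ?_⟩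
  exact ContinuousLinearMap.pow_apply_mem_of_invariant
    (TB (t / (2 * n)) * TA (t / n) * TB (t / (2 * n)))
    (fun x hx => hinvB (t / (2 * n)) _ (hinvA (t / n) _ (hinvB (t / (2 * n)) x hx))) n
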